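/- Let $k$ be an extension field of $\mathbb C$. An ideal $\mathcal I\subset\mathcal O_{\mathbb P^2_k}$ has (finite) colength $d$ if its Hilbert function $\varphi(n)=\dim_k H^0(\mathbb P^2_k,\mathcal I(n))$, $n\in\mathbb N$, satisfies $\varphi(n)=\binom{n+2}{2}-d$ for all $n\gg 0$. Equivalently, such ideals are the saturated homogeneous ideals of $k[x,y,z]$ with this Hilbert polynomial, $H^0(\mathcal I(n))$ being the part of degree $n$. For a Hilbert function $\varphi$ of colength $d$ put $\varphi'(n)=\varphi(n)-\varphi(n-1)$ (with $\varphi(-1)=0$), $$\operatorname{reg}(\varphi)=\min\{n\in\mathbb N: \varphi'(n)=n+1\},\qquad g^*(\varphi)=\sum_{n=0}^{d}\varphi(n)-\binom{d+3}{3}+d^2+1 ,$$ and for $d\ge 5$ put $g(d)=\frac14(d-2)^2$ if $d$ is even and $g(d)=\frac14(d-1)(d-3)$ if $d$ is odd. Let $\mathcal I\subset\mathcal O_{\mathbb P^2_k}$ be an ideal of colength $d\ge 5$ with Hilbert function $\varphi$ such that $g^*(\varphi)>g(d)$, and let $m=\operatorname{reg}(\varphi)$. Then there are a linear form $\ell\ne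 0$, an ideal $\mathcal K\subset\mathcal O_{\mathbb P^2_k}$ of finite colength $c$ and a form $f\in H^0(\mathcal K(m))$ such that $$\mathcal I=\ell\,\mathcal K(-1)+f\,\mathcal O_{\mathbb P^2}(-m).$$ For every such decomposition (with $m=\operatorname{reg}(\varphi)$) one has $m+c=d$ and $m\ge c+2$. If moreover $c\ge 5$ and the Hilbert function $\psi$ of $\mathcal K$ satisfies $g^*(\psi)\le g(c)$, then $m\ge 2c+1$. -/

import Mathlib

open MvPolynomial

/-- The degree-`n` part of an ideal `I` of `k[x,y,z]`, as a `k`-vector space. For a saturated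
homogeneous ideal `I` with associated ideal sheaf `𝓘` on the projective plane this is the space
`H⁰(ℙ², 𝓘(n))`. -/
noncomputable def degreePart {k : Type*} [Field k] (I : Ideal (MvPolynomial (Fin 3) k)) (n : ℕ) :
    Submodule k (MvPolynomial (Fin 3) k) :=
  I.restrictScalars k ⊓ homogeneousSubmodule (Fin 3) k n

/-- The Hilbert function `φ(n) = dim_k H⁰(ℙ², 𝓘(n))`, for `n ∈ ℕ`. -/
noncomputable def hilbertFn {k : Type*} [Field k] (I : Ideal (MvPolynomial (Fin 3) k))
    (n : ℕ) : ℕ :=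
  Module.finrank k (degreePart I n)

/-- `I` is saturated with respect to the irrelevant ideal `(x, y, z)`. -/
def IsSaturated {k : Type*} [Field k] (I : Ideal (MvPolynomial (Fin 3) k)) : Prop :=
  ∀ (F : MvPolynomial (Fin 3) k) (N : ℕ), (∀ i : Fin 3, X i ^ N * F ∈ I) → F ∈ I

/-- `I` is (the saturated homogeneous ideal of) an ideal sheaf of finite colength `d` on the
projective plane over `k`: its Hilbert polynomial is `(n+2 choose 2) - d`. Ideal sheaves on
`ℙ²` are identified with saturated homogeneous ideals of `k[x,y,z]`. -/
structure IsIdealOfColength {k : Type*} [Field k] (I : Ideal (MvPolynomial (Fin 3) k))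
    (d : ℕ) : Prop where
  homogeneous : ∀ F ∈ I, ∀ n : ℕ, homogeneousComponent n F ∈ I
  isSaturated : IsSaturated I
  hilbert_eventually : ∃ n₀ : ℕ, ∀ n ≥ n₀, hilbertFn I n + d = (n + 2).choose 2

/-- The difference function `φ'(n) = φ(n) - φ(n-1)`, where `φ(-1) = 0`. -/
def diffFn (φ : ℕ → ℕ) : ℕ → ℤ
  | 0 => φ 0
  | n + 1 => φ (n + 1) - φ n

/-- The regularity `reg(φ) = min {n ∈ ℕ | φ'(n) = n + 1}` of a Hilbert function `φ`. -/
noncomputable def hilbertReg (φ : ℕ → ℕ) : ℕ :=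
  sInf {n : ℕ | diffFn φ n = n + 1}

/-- `g*(φ) = ∑_{n=0}^{d} φ(n) - (d+3 choose 3) + d² + 1` for a Hilbert function `φ` of
colength `d`. -/
def gStar (d : ℕ) (φ : ℕ → ℕ) : ℤ :=
  (∑ n ∈ Finset.range (d + 1), (φ n : ℤ)) - ((d + 3).choose 3 : ℤ) + (d : ℤ) ^ 2 + 1

/-- The deformation bound `g(d)`, which is meant for `d ≥ 5`. -/
def deformationBound (d : ℕ) : ℚ :=
  if Even d then ((d : ℚ) - 2) ^ 2 / 4 else ((d : ℚ) - 1) * ((d : ℚ) - 3) / 4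

/-- The decomposition `𝓘 = ℓ 𝓚(-1) + f 𝓞(-m)`, where `ℓ ≠ 0` is a linear form, `𝓚` is an ideal
of colength `c` and `f ∈ H⁰(𝓚(m))` is a form of degree `m`. -/
structure IsDecomposition {k : Type*} [Field k] (I : Ideal (MvPolynomial (Fin 3) k)) (m : ℕ)
    (ℓ : MvPolynomial (Fin 3) k) (K : Ideal (MvPolynomial (Fin 3) k)) (c : ℕ)
    (f : MvPolynomial (Fin 3) k) : Prop where
  linear : ℓ.IsHomogeneous 1
  linear_ne_zero : ℓ ≠ 0
  colength : IsIdealOfColength K c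
  form_mem : f ∈ degreePart K m
  eq : I = Ideal.span {ℓ} * K ⊔ Ideal.span {f}

/-! Since `k` is infinite and `I` is saturated, some linear form `h` is a non-zero-divisor modulo
`I`. Hence `φ'(n)` is the dimension of the space of restrictions of `I_n` to the line `h = 0`. The
defect `q(n) = n + 1 - φ'(n)` is non-increasing once `q(n) ≤ n`, vanishes exactly from the
regularity `m` on, has total sum `d`, and satisfies `g*(φ) = 1 + ∑ (i - 1) q(i)`
(`IsDefect.gStar_eq`).

If `q(m-2) ≥ 2`, then `q(i) ≥ 2` for `1 ≤ i ≤ m-2`, which forces `g*(φ) ≤ g(d)`. So `q(m-2) = q(m-1)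
= 1` (`IsDefect.last_eq_one`).

These two ones mean that on a general line the restrictions of `I_{m-1}` share a zero. Coprime `F, G
∈ I_{m-1}` meet in finitely many points, which a general line avoids; so `I_{m-1}` has a common
prime factor (`exists_common_prime`), and codimension one on the line makes it a linear form `ℓ`.

Put `K = (I : ℓ)`. Restricting to `ℓ = 0` instead gives zero below degree `m` and all multiples of a
single form of degree `m` afterwards; a lift of that form is `f` (`exists_decomposition`).

Conversely, any decomposition has `ℓ ∤ f` and `K = (I : ℓ)`, so the defects satisfy `q(0) = 1` and
`q(n+1) = p(n) + [n+1 < m]`. The numerical claims follow by summing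
(`IsDefect.add_colength_of_shift`). -/

section Homogeneous

/-! ### Homogeneous components and divisibility. -/

variable {σ k : Type*} [Field k]

theorem homogeneousComponent_mul_of_isHomogeneous {h : MvPolynomial σ k} {e : ℕ}
    (hh : h.IsHomogeneous e) (F : MvPolynomial σ k) (n : ℕ) :
    homogeneousComponent (e + n) (h * F) = h * homogeneousComponent n F := by
  conv_lhs => rw [← sum_homogeneousComponent F, Finset.mul_sum, map_sum]
  by_cases hn : n ∈ Finset.range (F.totalDegree + 1)
  · rw [Finset.sum_eq_single_of_mem n hn]
    · exact homogeneousComponent_eq_self (hh.mul (homogeneousComponent_isHomogeneous n F))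
    · intro i _ hi
      rw [homogeneousComponent_of_mem (hh.mul (homogeneousComponent_isHomogeneous i F)), if_neg]
      omega
  · rw [Finset.sum_eq_zero, homogeneousComponent_eq_zero, mul_zero]
    · simpa using hn
    · intro i hi
      rw [homogeneousComponent_of_mem (hh.mul (homogeneousComponent_isHomogeneous i F)), if_neg]
      intro h'
      exact hn (by have : n = i := by omega
                   rwa [this])

theorem eq_homogeneousComponent_of_forall_ne {F : MvPolynomial σ k} {n : ℕ}
    (h : ∀ i, i ≠ n → homogeneousComponent i F = 0) : F.IsHomogeneous n := by
  rw [← sum_homogeneousComponent F]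
  refine IsHomogeneous.sum _ _ _ fun i _ => ?_
  by_cases hi : i = n
  · rw [hi]; exact homogeneousComponent_isHomogeneous n F
  · rw [h i hi]; exact isHomogeneous_zero _ _ _

theorem isHomogeneous_of_mul {h F : MvPolynomial σ k} {e n : ℕ}
    (hh : h.IsHomogeneous e) (h0 : h ≠ 0) (hF : (h * F).IsHomogeneous (e + n)) :
    F.IsHomogeneous n := by
  refine eq_homogeneousComponent_of_forall_ne fun i hi => ?_
  have := homogeneousComponent_mul_of_isHomogeneous hh F i
  rw [homogeneousComponent_of_mem hF, if_neg (by omega)] at this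
  exact (mul_eq_zero.mp this.symm).resolve_left h0

theorem homogeneousComponent_totalDegree_ne_zero {F : MvPolynomial σ k} (hF : F ≠ 0) :
    homogeneousComponent F.totalDegree F ≠ 0 := by
  intro h0
  obtain ⟨d, hd, hd'⟩ := Finset.exists_mem_eq_sup F.support (support_nonempty.mpr hF)
    (fun s : σ →₀ ℕ => s.degree)
  have h1 : d.degree = F.totalDegree := by
    rw [← hd']; rfl
  have := coeff_homogeneousComponent F.totalDegree F d
  rw [if_pos h1, h0, coeff_zero] at this
  exact (mem_support_iff.mp hd) this.symm

/-- If `F = p * q` is homogeneous, its degree is the sum of the degrees of `p` and `q`, so `F` is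
the product of their top components. This replaces a common factor by a homogeneous one. -/
theorem homogeneousComponent_totalDegree_dvd {p F : MvPolynomial σ k} {n : ℕ}
    (hF : F.IsHomogeneous n) (hp : p ∣ F) : homogeneousComponent p.totalDegree p ∣ F := by
  by_cases hF0 : F = 0
  · simp [hF0]
  obtain ⟨q, rfl⟩ := hp
  have hp0 : p ≠ 0 := left_ne_zero_of_mul hF0
  have hq0 : q ≠ 0 := right_ne_zero_of_mul hF0
  have hn : n = p.totalDegree + q.totalDegree := by
    rw [← totalDegree_mul_of_isDomain hp0 hq0, hF.totalDegree hF0]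
  refine ⟨homogeneousComponent q.totalDegree q, ?_⟩
  rw [← homogeneousComponent_eq_self hF, hn, ← sum_homogeneousComponent p, Finset.sum_mul, map_sum,
    sum_homogeneousComponent p]
  rw [Finset.sum_eq_single_of_mem p.totalDegree (by simp)]
  · exact homogeneousComponent_mul_of_isHomogeneous (homogeneousComponent_isHomogeneous _ _) _ _
  · intro i hi hne
    have hi' : i < p.totalDegree := by simp at hi; omega
    have := homogeneousComponent_mul_of_isHomogeneous (homogeneousComponent_isHomogeneous i p) q
      (p.totalDegree - i + q.totalDegree)
    rw [homogeneousComponent_eq_zero (p.totalDegree - i + q.totalDegree) q (by omega),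
      mul_zero] at this
    rw [← this]; congr 1; congr 1; omega

instance finiteDimensional_homogeneousSubmodule [Finite σ] (n : ℕ) :
    FiniteDimensional k (homogeneousSubmodule σ k n) :=
  Module.Finite.iff_fg.mpr (homogeneousSubmodule_fg σ k n)

theorem finrank_homogeneousSubmodule_fin_two (n : ℕ) :
    Module.finrank k (homogeneousSubmodule (Fin 2) k n) = n + 1 := by
  rw [homogeneousSubmodule_eq_finsupp_supported]
  have e : {d : Fin 2 →₀ ℕ | d.degree = n} =
      (Finset.univ.finsuppAntidiag n : Finset (Fin 2 →₀ ℕ)) := by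
    ext d
    simp [Finset.mem_finsuppAntidiag, Finsupp.degree_eq_sum]
  rw [LinearEquiv.finrank_eq (AddMonoidAlgebra.supportedEquivFinsupp _), e]
  simp [Finset.card_finsuppAntidiag_nat_eq_choose, Nat.add_comm 1 n]

end Homogeneous

/-! ### Restriction of forms to a line. -/

/-- A graded retraction of `k[x,y,z]` onto `k[u,v]` with kernel generated by the linear form `h`:
restriction of forms to the line `h = 0`. -/
structure LineRestriction {k : Type*} [Field k] (h : MvPolynomial (Fin 3) k) where
  res : MvPolynomial (Fin 3) k →ₐ[k] MvPolynomial (Fin 2) k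
  sec : MvPolynomial (Fin 2) k →ₐ[k] MvPolynomial (Fin 3) k
  res_isHomogeneous : ∀ (F : MvPolynomial (Fin 3) k) (n : ℕ),
    F.IsHomogeneous n → (res F).IsHomogeneous n
  sec_isHomogeneous : ∀ (F : MvPolynomial (Fin 2) k) (n : ℕ),
    F.IsHomogeneous n → (sec F).IsHomogeneous n
  res_sec : ∀ F, res (sec F) = F
  res_eq_zero_iff : ∀ F, res F = 0 ↔ h ∣ F

theorem exists_coeff_of_isHomogeneous_one {σ k : Type*} [Fintype σ] [Field k]
    {h : MvPolynomial σ k} (hh : h.IsHomogeneous 1) : ∃ a : σ → k, h = ∑ i, C (a i) * X i := by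
  have : h ∈ homogeneousSubmodule σ k 1 := hh
  rw [homogeneousSubmodule_one_eq_span_X, Submodule.mem_span_range_iff_exists_fun] at this
  obtain ⟨a, ha⟩ := this
  exact ⟨a, by rw [← ha]; simp [smul_eq_C_mul]⟩

/-- Some coefficient `a i` is nonzero, so `h = 0` can be solved for `X i`; the restriction
substitutes the solution, and the section includes the other two variables. -/
theorem exists_lineRestriction {k : Type*} [Field k] {h : MvPolynomial (Fin 3) k}
    (hh : h.IsHomogeneous 1) (h0 : h ≠ 0) : Nonempty (LineRestriction h) := by
  obtain ⟨a, ha⟩ := exists_coeff_of_isHomogeneous_one hh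
  obtain ⟨i, hi⟩ : ∃ i, a i ≠ 0 := by
    by_contra! hc
    exact h0 (by rw [ha]; simp [hc])
  have ha' : h = C (a i) * X i + ∑ j, C (a (i.succAbove j)) * X (i.succAbove j) := by
    rw [ha, Fin.sum_univ_succAbove _ i]
  obtain ⟨w, hw⟩ : ∃ w : MvPolynomial (Fin 2) k,
      w = ∑ j, C (a (i.succAbove j)) * X j := ⟨_, rfl⟩
  have hw1 : (C (-(a i)⁻¹) * w).IsHomogeneous 1 := by
    rw [hw]
    exact (IsHomogeneous.sum _ _ _ fun j _ => isHomogeneous_C_mul_X _ _).C_mul _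
  obtain ⟨g, hgi, hgj⟩ : ∃ g : Fin 3 → MvPolynomial (Fin 2) k,
      g i = C (-(a i)⁻¹) * w ∧ ∀ j, g (i.succAbove j) = X j :=
    ⟨i.insertNth (α := fun _ => MvPolynomial (Fin 2) k) (C (-(a i)⁻¹) * w) X,
      Fin.insertNth_apply_same _ _ _, fun j => Fin.insertNth_apply_succAbove _ _ _ _⟩
  obtain ⟨π, hπX, hπh⟩ : ∃ π : MvPolynomial (Fin 3) k →ₐ[k] MvPolynomial (Fin 2) k,
      (∀ j, π (X j) = g j) ∧ ∀ F n, F.IsHomogeneous n → (π F).IsHomogeneous n := by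
    refine ⟨aeval g, aeval_X g, fun F n hF => ?_⟩
    have := hF.aeval (n := 1) g fun j => by
      rcases Fin.eq_self_or_eq_succAbove i j with rfl | ⟨j', rfl⟩
      · rw [hgi]; exact hw1
      · rw [hgj]; exact isHomogeneous_X _ _
    rwa [one_mul] at this
  obtain ⟨s, hsX, hsh⟩ : ∃ s : MvPolynomial (Fin 2) k →ₐ[k] MvPolynomial (Fin 3) k,
      (∀ j, s (X j) = X (i.succAbove j)) ∧ ∀ F n, F.IsHomogeneous n → (s F).IsHomogeneous n := by
    refine ⟨aeval fun j => X (i.succAbove j), aeval_X _, fun F n hF => ?_⟩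
    have := hF.aeval (n := 1) (fun j => (X (i.succAbove j) : MvPolynomial (Fin 3) k))
      fun j => isHomogeneous_X _ _
    rwa [one_mul] at this
  have hπC : ∀ c, π (C c) = C c := fun c => π.commutes c
  have hsC : ∀ c, s (C c) = C c := fun c => s.commutes c
  have hC : (C (a i)⁻¹ : MvPolynomial (Fin 3) k) * C (a i) = 1 := by
    rw [← C_mul, inv_mul_cancel₀ hi, C_1]
  have hC2 : (C (a i)⁻¹ : MvPolynomial (Fin 2) k) * C (a i) = 1 := by
    rw [← C_mul, inv_mul_cancel₀ hi, C_1]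
  have hs : ∀ F, π (s F) = F := by
    intro F
    have : π.comp s = AlgHom.id k _ := by
      ext j : 1
      rw [AlgHom.comp_apply, hsX, hπX, hgj, AlgHom.id_apply]
    exact DFunLike.congr_fun this F
  have hsw : s w = ∑ j, C (a (i.succAbove j)) * X (i.succAbove j) := by
    rw [hw, map_sum]
    exact Finset.sum_congr rfl fun j _ => by rw [map_mul, hsC, hsX]
  -- Modulo `h` every polynomial equals its substituted version; this identifies the kernel.
  have hdvd : ∀ F, h ∣ F - s (π F) := by
    intro F
    induction F using MvPolynomial.induction_on with
    | C c => rw [hπC, hsC, sub_self]; exact dvd_zero _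
    | add p q hp hq =>
      have : p + q - s (π (p + q)) = (p - s (π p)) + (q - s (π q)) := by
        rw [map_add, map_add]; ring
      rw [this]; exact dvd_add hp hq
    | mul_X p j hp =>
      have hX : h ∣ X j - s (π (X j)) := by
        rcases Fin.eq_self_or_eq_succAbove i j with rfl | ⟨j', rfl⟩
        · rw [hπX, hgi, map_mul, hsC, hsw, ha']
          refine ⟨C (a j)⁻¹, ?_⟩
          rw [C_neg]
          linear_combination (-X j) * hC
        · rw [hπX, hgj, hsX, sub_self]; exact dvd_zero _
      have : p * X j - s (π (p * X j)) = (p - s (π p)) * X j + s (π p) * (X j - s (π (X j))) := by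
        rw [map_mul, map_mul]; ring
      rw [this]
      exact dvd_add (hp.mul_right _) (hX.mul_left _)
  have hπ0 : π h = 0 := by
    have : π (∑ j, C (a (i.succAbove j)) * X (i.succAbove j)) = w := by
      rw [hw, map_sum]
      exact Finset.sum_congr rfl fun j _ => by rw [map_mul, hπC, hπX, hgj]
    rw [ha', map_add, this, map_mul, hπC, hπX, hgi, C_neg]
    linear_combination (-w) * hC2
  refine ⟨⟨π, s, hπh, hsh, hs, fun F => ⟨fun hF => ?_, ?_⟩⟩⟩
  · have := hdvd F
    rwa [hF, map_zero, sub_zero] at this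
  · rintro ⟨G, rfl⟩
    rw [map_mul, hπ0, zero_mul]

/-- Multiplication by a fixed polynomial, as a linear map. -/
noncomputable def polyMul {σ k : Type*} [Field k] (a : MvPolynomial σ k) :
    MvPolynomial σ k →ₗ[k] MvPolynomial σ k where
  toFun F := a * F
  map_add' := mul_add a
  map_smul' c F := mul_smul_comm c a F

theorem polyMul_apply {σ k : Type*} [Field k] (a F : MvPolynomial σ k) : polyMul a F = a * F := rfl

theorem polyMul_injective {σ k : Type*} [Field k] {a : MvPolynomial σ k} (ha : a ≠ 0) :
    Function.Injective (polyMul a) := fun _ _ h => mul_left_cancel₀ ha h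

theorem finrank_map_polyMul {σ k : Type*} [Field k] {a : MvPolynomial σ k} (ha : a ≠ 0)
    (p : Submodule k (MvPolynomial σ k)) :
    Module.finrank k (p.map (polyMul a)) = Module.finrank k p :=
  (LinearEquiv.finrank_eq (p.equivMapOfInjective _ (polyMul_injective ha))).symm

/-! ### Growth of spaces of binary forms. -/

section BinaryForms

variable {k : Type*} [Field k]

/-- Subspaces of binary forms grow by at least one dimension in each degree. -/
theorem finrank_add_one_le_of_mul_mem {n : ℕ} {V W : Submodule k (MvPolynomial (Fin 2) k)}
    (hV : V ≤ homogeneousSubmodule (Fin 2) k n) (hW : W ≤ homogeneousSubmodule (Fin 2) k (n + 1))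
    (hV0 : V ≠ ⊥) (hVW : ∀ F ∈ V, ∀ i, X i * F ∈ W) :
    Module.finrank k V + 1 ≤ Module.finrank k W := by
  have : FiniteDimensional k W := Submodule.finiteDimensional_of_le hW
  have : FiniteDimensional k V := Submodule.finiteDimensional_of_le hV
  have hle : V.map (polyMul (X 0)) ≤ W := by
    rintro _ ⟨F, hF, rfl⟩; exact hVW F hF 0
  have hdim : Module.finrank k (V.map (polyMul (X 0))) = Module.finrank k V :=
    finrank_map_polyMul (X_ne_zero 0) V
  by_contra! hlt
  have heq : V.map (polyMul (X 0)) = W := Submodule.eq_of_le_of_finrank_le hle (by omega)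
  have hndvd : ¬ (X 0 : MvPolynomial (Fin 2) k) ∣ X 1 := by
    rw [X_dvd_X]; simp
  -- With `X 0 * V = W`, also `X 1 * V ⊆ X 0 * V`, so divisibility of all of `V` by a power of `X 0`
  -- improves by one each time. This contradicts the fixed degree.
  have hpow : ∀ a : ℕ, ∀ F ∈ V, (X 0 : MvPolynomial (Fin 2) k) ^ a ∣ F := by
    intro a
    induction a with
    | zero => intro F _; simp
    | succ a ih =>
      intro F hF
      have h1 := hVW F hF 1
      rw [← heq] at h1
      obtain ⟨G, hG, hGF⟩ := h1
      have h2 : (X 0 : MvPolynomial (Fin 2) k) ^ (a + 1) ∣ X 1 * F := by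
        rw [← hGF, pow_succ']
        exact mul_dvd_mul_left _ (ih G hG)
      exact ((X_prime).pow_dvd_of_dvd_mul_left _ hndvd h2)
  obtain ⟨F, hF, hF0⟩ := V.ne_bot_iff.mp hV0
  obtain ⟨G, hG⟩ := hpow (n + 1) F hF
  have hG0 : G ≠ 0 := by rintro rfl; exact hF0 (by simpa using hG)
  have h3 := (hV hF : F.IsHomogeneous n).totalDegree hF0
  rw [hG, totalDegree_mul_of_isDomain (pow_ne_zero _ (X_ne_zero 0)) hG0, totalDegree_X_pow] at h3
  omega

/-- Two consecutive subspaces of binary forms of codimension one: the second one is cut out by a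
common linear factor. -/
theorem exists_linear_factor_of_codim_one {n : ℕ} {V W : Submodule k (MvPolynomial (Fin 2) k)}
    (hV : V ≤ homogeneousSubmodule (Fin 2) k n) (hW : W ≤ homogeneousSubmodule (Fin 2) k (n + 1))
    (hVW : ∀ F ∈ V, ∀ i, X i * F ∈ W) (hVn : Module.finrank k V = n)
    (hWn : Module.finrank k W = n + 1) :
    ∃ ℓ : MvPolynomial (Fin 2) k, ℓ.IsHomogeneous 1 ∧ ℓ ≠ 0 ∧ ∀ F ∈ W, ℓ ∣ F := by
  have : FiniteDimensional k W := Submodule.finiteDimensional_of_le hW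
  have : FiniteDimensional k V := Submodule.finiteDimensional_of_le hV
  obtain ⟨w, hw, hwV⟩ : ∃ w ∈ homogeneousSubmodule (Fin 2) k n, w ∉ V := by
    by_contra! hc
    have : V = homogeneousSubmodule (Fin 2) k n := le_antisymm hV hc
    rw [this, finrank_homogeneousSubmodule_fin_two] at hVn
    omega
  have hVw : V ⊔ k ∙ w = homogeneousSubmodule (Fin 2) k n := by
    refine Submodule.eq_of_le_of_finrank_le (sup_le hV ?_) ?_
    · rwa [Submodule.span_singleton_le_iff_mem]
    · rw [finrank_homogeneousSubmodule_fin_two]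
      have h1 : V < V ⊔ k ∙ w := by
        refine lt_of_le_of_ne le_sup_left fun h => hwV ?_
        rw [h]; exact Submodule.mem_sup_right (Submodule.mem_span_singleton_self w)
      have := Submodule.finrank_lt_finrank_of_lt h1
      omega
  -- `W` has codimension one, so `ℓ * w ∈ W` is a single linear condition on the two-dimensional
  -- space of linear forms `ℓ`.
  obtain ⟨a, b, hab, habW⟩ : ∃ a b : k, (a ≠ 0 ∨ b ≠ 0) ∧ (C a * X 0 + C b * X 1) * w ∈ W := by
    by_cases h0 : X 0 * w ∈ W
    · exact ⟨1, 0, Or.inl one_ne_zero, by simpa using h0⟩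
    have hle : W ⊔ k ∙ (X 0 * w) = homogeneousSubmodule (Fin 2) k (n + 1) := by
      have hX : (X 0 * w) ∈ homogeneousSubmodule (Fin 2) k (n + 1) := by
        rw [add_comm]; exact (isHomogeneous_X k 0).mul hw
      refine Submodule.eq_of_le_of_finrank_le (sup_le hW ?_) ?_
      · rwa [Submodule.span_singleton_le_iff_mem]
      · rw [finrank_homogeneousSubmodule_fin_two]
        have h1 : W < W ⊔ k ∙ (X 0 * w) := by
          refine lt_of_le_of_ne le_sup_left fun h => h0 ?_
          rw [h]; exact Submodule.mem_sup_right (Submodule.mem_span_singleton_self _)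
        have hfd : FiniteDimensional k ↥(W ⊔ k ∙ (X 0 * w)) := inferInstance
        have := Submodule.finrank_lt_finrank_of_lt h1
        omega
    have h1 : X 1 * w ∈ W ⊔ k ∙ (X 0 * w) := by
      rw [hle, add_comm]; exact (isHomogeneous_X k 1).mul hw
    obtain ⟨y, hy, z, hz, hyz⟩ := Submodule.mem_sup.mp h1
    obtain ⟨c, rfl⟩ := Submodule.mem_span_singleton.mp hz
    refine ⟨-c, 1, Or.inr one_ne_zero, ?_⟩
    have : (C (-c) * X 0 + C 1 * X 1) * w = y := by
      rw [add_mul, C_1, one_mul, ← hyz, smul_eq_C_mul, C_neg]; ring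
    rwa [this]
  let ℓ : MvPolynomial (Fin 2) k := C a * X 0 + C b * X 1
  have hℓ1 : ℓ.IsHomogeneous 1 := (isHomogeneous_C_mul_X _ _).add (isHomogeneous_C_mul_X _ _)
  have hℓ0 : ℓ ≠ 0 := by
    intro h0
    have ha : coeff (Finsupp.single 0 1) ℓ = a := by
      simp [ℓ, coeff_C_mul, coeff_X, Finsupp.single_left_inj]
    have hb : coeff (Finsupp.single 1 1) ℓ = b := by
      simp [ℓ, coeff_C_mul, coeff_X, Finsupp.single_left_inj]
    rw [h0, coeff_zero] at ha hb
    rcases hab with h | h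
    · exact h ha.symm
    · exact h hb.symm
  refine ⟨ℓ, hℓ1, hℓ0, ?_⟩
  have hle : (homogeneousSubmodule (Fin 2) k n).map (polyMul ℓ) ≤ W := by
    rintro _ ⟨F, hF, rfl⟩
    rw [← hVw] at hF
    obtain ⟨y, hy, z, hz, rfl⟩ := Submodule.mem_sup.mp hF
    obtain ⟨c, rfl⟩ := Submodule.mem_span_singleton.mp hz
    rw [map_add, map_smul]
    refine W.add_mem ?_ (W.smul_mem _ habW)
    change (C a * X 0 + C b * X 1) * y ∈ W
    rw [add_mul, mul_assoc, mul_assoc, ← smul_eq_C_mul, ← smul_eq_C_mul]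
    exact W.add_mem (W.smul_mem _ (hVW y hy 0)) (W.smul_mem _ (hVW y hy 1))
  have heq := Submodule.eq_of_le_of_finrank_le hle (by
    rw [finrank_map_polyMul hℓ0, finrank_homogeneousSubmodule_fin_two, hWn])
  intro F hF
  rw [← heq] at hF
  obtain ⟨G, _, rfl⟩ := hF
  exact ⟨G, rfl⟩

end BinaryForms

/-! ### Hilbert functions and restriction to a line. -/

section Restriction

variable {k : Type*} [Field k]

instance finiteDimensional_degreePart (I : Ideal (MvPolynomial (Fin 3) k)) (n : ℕ) :
    FiniteDimensional k (degreePart I n) :=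
  Submodule.finiteDimensional_of_le inf_le_right

namespace LineRestriction

variable {h : MvPolynomial (Fin 3) k} (ρ : LineRestriction h)

/-- The restrictions to the line of the forms of degree `n` in the ideal `I`. -/
noncomputable def image (I : Ideal (MvPolynomial (Fin 3) k)) (n : ℕ) :
    Submodule k (MvPolynomial (Fin 2) k) :=
  (degreePart I n).map ρ.res.toLinearMap

theorem res_mem_image {I : Ideal (MvPolynomial (Fin 3) k)} {n : ℕ} {F : MvPolynomial (Fin 3) k}
    (hF : F ∈ degreePart I n) : ρ.res F ∈ ρ.image I n := ⟨F, hF, rfl⟩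

theorem image_le (I : Ideal (MvPolynomial (Fin 3) k)) (n : ℕ) :
    ρ.image I n ≤ homogeneousSubmodule (Fin 2) k n := by
  rintro _ ⟨F, hF, rfl⟩
  exact ρ.res_isHomogeneous F n hF.2

instance (I : Ideal (MvPolynomial (Fin 3) k)) (n : ℕ) : FiniteDimensional k (ρ.image I n) :=
  Submodule.finiteDimensional_of_le (ρ.image_le I n)

theorem mul_mem_image {I : Ideal (MvPolynomial (Fin 3) k)} {n e : ℕ} {w v : MvPolynomial (Fin 2) k}
    (hw : w ∈ ρ.image I n) (hv : v.IsHomogeneous e) : v * w ∈ ρ.image I (n + e) := by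
  obtain ⟨F, hF, rfl⟩ := hw
  refine ⟨ρ.sec v * F, ⟨I.mul_mem_left _ hF.1, ?_⟩, ?_⟩
  · rw [add_comm]; exact (ρ.sec_isHomogeneous _ _ hv).mul hF.2
  · simp [ρ.res_sec]

theorem finrank_image_le (I : Ideal (MvPolynomial (Fin 3) k)) (n : ℕ) :
    Module.finrank k (ρ.image I n) ≤ n + 1 := by
  rw [← finrank_homogeneousSubmodule_fin_two (k := k)]
  exact Submodule.finrank_mono (ρ.image_le I n)

theorem finrank_image_succ (I : Ideal (MvPolynomial (Fin 3) k)) (n : ℕ)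
    (h0 : ρ.image I n ≠ ⊥) :
    Module.finrank k (ρ.image I n) + 1 ≤ Module.finrank k (ρ.image I (n + 1)) :=
  finrank_add_one_le_of_mul_mem (ρ.image_le I n) (ρ.image_le I (n + 1)) h0
    fun _ hF i => ρ.mul_mem_image hF (isHomogeneous_X k i)

theorem finrank_image_succ_le (I : Ideal (MvPolynomial (Fin 3) k)) (n : ℕ) :
    Module.finrank k (ρ.image I n) ≤ Module.finrank k (ρ.image I (n + 1)) := by
  by_cases h0 : ρ.image I n = ⊥
  · rw [h0, finrank_bot]; exact Nat.zero_le _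
  · exact (Nat.le_succ _).trans (ρ.finrank_image_succ I n h0)

theorem hilbertFn_eq_add_finrank_ker (I : Ideal (MvPolynomial (Fin 3) k)) (n : ℕ) :
    hilbertFn I n = Module.finrank k (ρ.image I n) +
      Module.finrank k (LinearMap.ker (ρ.res.toLinearMap.domRestrict (degreePart I n))) := by
  rw [hilbertFn, ← LinearMap.finrank_range_add_finrank_ker
    (ρ.res.toLinearMap.domRestrict (degreePart I n)), LinearMap.range_domRestrict]
  rfl

/-- Dimension count in the exact sequence `0 → J_n → I_{n+1} → image → 0`, whose first map is
multiplication by `h` and where `J = (I : h)`. -/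
theorem hilbertFn_succ (hh : h.IsHomogeneous 1) (hh0 : h ≠ 0)
    {I J : Ideal (MvPolynomial (Fin 3) k)} (hIJ : ∀ F, h * F ∈ I ↔ F ∈ J) (n : ℕ) :
    hilbertFn I (n + 1) = hilbertFn J n + Module.finrank k (ρ.image I (n + 1)) := by
  rw [ρ.hilbertFn_eq_add_finrank_ker, add_comm, hilbertFn]
  congr 1
  let g : degreePart J n →ₗ[k] degreePart I (n + 1) :=
    LinearMap.restrict (polyMul h) fun F hF =>
      ⟨(hIJ F).mpr hF.1, by
        have := hh.mul hF.2
        rwa [add_comm] at this⟩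
  have hg : Function.Injective g := fun a b hab =>
    Subtype.ext (polyMul_injective hh0 (congrArg Subtype.val hab))
  rw [← LinearMap.finrank_range_of_inj hg]
  suffices hker : LinearMap.ker (ρ.res.toLinearMap.domRestrict (degreePart I (n + 1))) =
      LinearMap.range g by rw [hker]
  ext ⟨F, hF⟩
  rw [LinearMap.mem_ker, LinearMap.mem_range]
  constructor
  · intro h1
    obtain ⟨G, rfl⟩ := (ρ.res_eq_zero_iff F).mp h1
    refine ⟨⟨G, (hIJ G).mp hF.1, isHomogeneous_of_mul hh hh0 ?_⟩, rfl⟩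
    rw [add_comm]; exact hF.2
  · rintro ⟨G, hG⟩
    have : F = h * G.1 := (congrArg Subtype.val hG).symm
    exact (ρ.res_eq_zero_iff F).mpr ⟨G, this⟩

theorem hilbertFn_zero (hh : h.IsHomogeneous 1) (hh0 : h ≠ 0)
    (I : Ideal (MvPolynomial (Fin 3) k)) :
    hilbertFn I 0 = Module.finrank k (ρ.image I 0) := by
  rw [ρ.hilbertFn_eq_add_finrank_ker, LinearMap.ker_eq_bot.mpr, finrank_bot, add_zero]
  rw [injective_iff_map_eq_zero]
  rintro ⟨F, hF⟩ h1
  obtain ⟨G, hG⟩ := (ρ.res_eq_zero_iff F).mp h1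
  by_contra hF0
  have hF0 : F ≠ 0 := fun h => hF0 (Subtype.ext h)
  have hG0 : G ≠ 0 := by rintro rfl; simp at hG; exact hF0 hG
  have := hF.2.totalDegree hF0
  rw [hG, totalDegree_mul_of_isDomain hh0 hG0, hh.totalDegree hh0] at this
  omega

end LineRestriction

end Restriction

/-! ### Numerics of the defect. -/

/-- `q n = n + 1 - φ'(n)` is the Hilbert function of a graded quotient of `k[u,v]`. -/
structure IsDefect (φ q : ℕ → ℕ) : Prop where
  diff_add : ∀ n, diffFn φ n + q n = n + 1
  le_succ : ∀ n, q n ≤ n + 1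
  anti : ∀ n, q n ≤ n → q (n + 1) ≤ q n

namespace IsDefect

variable {φ q : ℕ → ℕ}

theorem add_sum (H : IsDefect φ q) (n : ℕ) :
    φ n + ∑ i ∈ Finset.range (n + 1), q i = (n + 2).choose 2 := by
  induction n with
  | zero =>
    have := H.diff_add 0
    simp only [diffFn] at this
    simp
    omega
  | succ n ih =>
    have := H.diff_add (n + 1)
    simp only [diffFn] at this
    rw [Finset.sum_range_succ, show (n + 1 + 2).choose 2 = (n + 2) + (n + 2).choose 2 by
      rw [Nat.choose_succ_succ' (n + 2) 1, Nat.choose_one_right]]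
    push_cast at this
    omega

theorem le_of_le (H : IsDefect φ q) {a n : ℕ} (ha : q a ≤ a) (hn : a ≤ n) : q n ≤ q a := by
  induction n, hn using Nat.le_induction with
  | base => exact le_rfl
  | succ n hn ih => exact (H.anti n (by omega)).trans ih

theorem reg_eq (H : IsDefect φ q) : hilbertReg φ = sInf {n | q n = 0} := by
  unfold hilbertReg
  congr 1
  ext n
  have := H.diff_add n
  simp only [Set.mem_ofPred_eq]
  omega

theorem sum_eventually (H : IsDefect φ q) {d : ℕ}
    (hd : ∃ n₀ : ℕ, ∀ n ≥ n₀, φ n + d = (n + 2).choose 2) :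
    ∃ n₀, ∀ n ≥ n₀, ∑ i ∈ Finset.range (n + 1), q i = d := by
  obtain ⟨n₀, h⟩ := hd
  refine ⟨n₀, fun n hn => ?_⟩
  have h1 := h n hn
  have h2 := H.add_sum n
  omega

theorem exists_eq_zero (H : IsDefect φ q) {d : ℕ}
    (hd : ∃ n₀ : ℕ, ∀ n ≥ n₀, φ n + d = (n + 2).choose 2) : ∃ n, q n = 0 := by
  obtain ⟨n₀, h⟩ := H.sum_eventually hd
  have h1 := h n₀ le_rfl
  have h2 := h (n₀ + 1) (by omega)
  rw [Finset.sum_range_succ, h1] at h2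
  exact ⟨n₀ + 1, by omega⟩

theorem eq_zero_of_reg_le (H : IsDefect φ q) {d : ℕ}
    (hd : ∃ n₀ : ℕ, ∀ n ≥ n₀, φ n + d = (n + 2).choose 2) {n : ℕ} (hn : hilbertReg φ ≤ n) :
    q n = 0 := by
  have h0 : q (hilbertReg φ) = 0 := by
    rw [H.reg_eq]; exact Nat.sInf_mem (H.exists_eq_zero hd)
  have := H.le_of_le (a := hilbertReg φ) (by omega) hn
  omega

theorem pos_of_lt_reg (H : IsDefect φ q) {n : ℕ} (hn : n < hilbertReg φ) : 0 < q n := by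
  rw [H.reg_eq] at hn
  exact Nat.pos_of_ne_zero fun h => absurd (Nat.sInf_le (s := {n | q n = 0}) h) (not_le.mpr hn)

theorem reg_le (H : IsDefect φ q) {n : ℕ} (hn : q n = 0) : hilbertReg φ ≤ n := by
  rw [H.reg_eq]; exact Nat.sInf_le hn

theorem sum_eq (H : IsDefect φ q) {d : ℕ}
    (hd : ∃ n₀ : ℕ, ∀ n ≥ n₀, φ n + d = (n + 2).choose 2) {N : ℕ} (hN : hilbertReg φ ≤ N) :
    ∑ i ∈ Finset.range N, q i = d := by
  obtain ⟨n₀, h⟩ := H.sum_eventually hd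
  rw [← h (n₀ + N) (by omega)]
  refine Finset.sum_subset (fun i hi => ?_) fun i _ hi => ?_
  · simp at hi ⊢; omega
  · simp at hi; exact H.eq_zero_of_reg_le hd (by omega)

theorem reg_le_colength (H : IsDefect φ q) {d : ℕ}
    (hd : ∃ n₀ : ℕ, ∀ n ≥ n₀, φ n + d = (n + 2).choose 2) : hilbertReg φ ≤ d := by
  rw [← H.sum_eq hd le_rfl]
  have : ∑ i ∈ Finset.range (hilbertReg φ), 1 ≤ ∑ i ∈ Finset.range (hilbertReg φ), q i :=
    Finset.sum_le_sum fun i hi => H.pos_of_lt_reg (Finset.mem_range.mp hi)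
  simpa using this

theorem sum_hilbertFn (H : IsDefect φ q) (N : ℕ) :
    (∑ n ∈ Finset.range (N + 1), (φ n : ℤ)) =
      ((N + 3).choose 3 : ℤ) - ∑ i ∈ Finset.range (N + 1), ((N : ℤ) + 1 - i) * q i := by
  induction N with
  | zero =>
    have := H.add_sum 0
    simp at this ⊢
    omega
  | succ N ih =>
    have h1 := H.add_sum (N + 1)
    rw [Finset.sum_range_succ, ih, Finset.sum_range_succ _ (N + 1),
      Nat.choose_succ_succ' (N + 3) 2]
    rw [Finset.sum_range_succ] at h1
    zify at h1
    have h2 : ∑ i ∈ Finset.range (N + 1), (((N + 1 : ℕ) : ℤ) + 1 - i) * (q i : ℤ) =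
        ∑ i ∈ Finset.range (N + 1), ((N : ℤ) + 1 - i) * q i +
        ∑ i ∈ Finset.range (N + 1), (q i : ℤ) := by
      rw [← Finset.sum_add_distrib]
      exact Finset.sum_congr rfl fun i _ => by push_cast; ring
    rw [h2]
    push_cast at h1 ⊢
    linarith

/-- Summing `φ` twice turns `g*` into a weighted sum of the defect; the term `d²` cancels against `d
* ∑ q = d²`. -/
theorem gStar_eq (H : IsDefect φ q) {d : ℕ}
    (hd : ∃ n₀ : ℕ, ∀ n ≥ n₀, φ n + d = (n + 2).choose 2) {N : ℕ} (hN : hilbertReg φ ≤ N) :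
    gStar d φ = 1 + ∑ i ∈ Finset.range N, ((i : ℤ) - 1) * q i := by
  have h1 : ∑ i ∈ Finset.range N, ((i : ℤ) - 1) * q i =
      ∑ i ∈ Finset.range (d + 1), ((i : ℤ) - 1) * q i := by
    trans ∑ i ∈ Finset.range (hilbertReg φ), ((i : ℤ) - 1) * q i
    · symm
      refine Finset.sum_subset (fun i hi => ?_) fun i _ hi => ?_
      · simp at hi ⊢; omega
      · simp at hi; rw [H.eq_zero_of_reg_le hd hi]; simp
    · have := H.reg_le_colength hd
      refine Finset.sum_subset (fun i hi => ?_) fun i _ hi => ?_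
      · simp at hi ⊢; omega
      · simp at hi; rw [H.eq_zero_of_reg_le hd hi]; simp
  have h2 : ∑ i ∈ Finset.range (d + 1), ((d : ℤ) + 1 - i) * q i =
      d * ∑ i ∈ Finset.range (d + 1), (q i : ℤ) -
        ∑ i ∈ Finset.range (d + 1), ((i : ℤ) - 1) * q i := by
    rw [Finset.mul_sum, ← Finset.sum_sub_distrib]
    exact Finset.sum_congr rfl fun i _ => by ring
  have h3 := H.sum_eq hd (N := d + 1) (by have := H.reg_le_colength hd; omega)
  zify at h3
  rw [gStar, H.sum_hilbertFn, h2, h1, h3]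
  ring

end IsDefect

theorem sum_range_two_mul_sub (n : ℕ) (a : ℤ) :
    ∑ i ∈ Finset.range n, (2 * (i + 1 - a) : ℤ) = n * (n + 1) - 2 * n * a := by
  induction n with
  | zero => simp
  | succ n ih => rw [Finset.sum_range_succ, ih]; push_cast; ring

/-- After subtracting `M * ∑ q` all weights `i - 1 - M` are nonpositive, so each `q i` may be
replaced by its lower bound; the weight at `M + 1` is zero. -/
theorem sum_sub_le_of_two_le {q : ℕ → ℕ} (M : ℕ) (h0 : 1 ≤ q 0)
    (h2 : ∀ i, 1 ≤ i → i ≤ M → 2 ≤ q i) :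
    ∑ i ∈ Finset.range (M + 2), ((i : ℤ) - 1) * q i ≤
      M * ∑ i ∈ Finset.range (M + 2), (q i : ℤ) - (M + 1) ^ 2 := by
  have h1 : ∑ i ∈ Finset.range (M + 2), ((i : ℤ) - 1) * q i -
      M * ∑ i ∈ Finset.range (M + 2), (q i : ℤ) =
      ∑ i ∈ Finset.range (M + 2), ((i : ℤ) - 1 - M) * q i := by
    rw [Finset.mul_sum, ← Finset.sum_sub_distrib]
    exact Finset.sum_congr rfl fun i _ => by ring
  have h3 : ∑ i ∈ Finset.range M, (((i + 1 : ℕ) : ℤ) - 1 - M) * (q (i + 1) : ℤ) ≤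
      ∑ i ∈ Finset.range M, ((i : ℤ) - M) * 2 := by
    refine Finset.sum_le_sum fun i hi => ?_
    have hi' := Finset.mem_range.mp hi
    have := h2 (i + 1) (by omega) (by omega)
    push_cast
    nlinarith
  have h4 : ∑ i ∈ Finset.range M, ((i : ℤ) - M) * 2 = -(M * (M + 1)) := by
    have := sum_range_two_mul_sub M (M + 1)
    rw [show -((M : ℤ) * (M + 1)) = M * (M + 1) - 2 * M * (M + 1) by ring, ← this]
    exact Finset.sum_congr rfl fun i _ => by ring
  have h5 : ∑ i ∈ Finset.range (M + 2), ((i : ℤ) - 1 - M) * q i ≤ -(M + 1) ^ 2 := by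
    rw [Finset.sum_range_succ, Finset.sum_range_succ' _ M]
    have h6 : ((M : ℤ) + 1) * 1 ≤ (M + 1) * q 0 := by gcongr; exact_mod_cast h0
    push_cast at h3 ⊢
    linarith
  linarith

theorem sum_sub_le_of_pos {q : ℕ → ℕ} (r : ℕ) (hpos : ∀ i < r, 1 ≤ q i) :
    2 * ∑ i ∈ Finset.range r, ((i : ℤ) - 1) * q i ≤
      2 * (r - 2) * ∑ i ∈ Finset.range r, (q i : ℤ) - r * (r - 1) := by
  have h1 : 2 * ∑ i ∈ Finset.range r, ((i : ℤ) - 1) * q i -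
      2 * (r - 2) * ∑ i ∈ Finset.range r, (q i : ℤ) =
      ∑ i ∈ Finset.range r, (2 * (i + 1 - r) : ℤ) * q i := by
    rw [Finset.mul_sum, Finset.mul_sum, ← Finset.sum_sub_distrib]
    exact Finset.sum_congr rfl fun i _ => by ring
  have h3 : ∑ i ∈ Finset.range r, (2 * (i + 1 - r) : ℤ) * q i ≤
      ∑ i ∈ Finset.range r, (2 * (i + 1 - r) : ℤ) := by
    refine Finset.sum_le_sum fun i hi => ?_
    have hi' := Finset.mem_range.mp hi
    have := hpos i hi'
    nlinarith
  have h4 : ∑ i ∈ Finset.range r, (2 * (i + 1 - r) : ℤ) = -(r * (r - 1)) := by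
    rw [sum_range_two_mul_sub]; ring
  linarith

/-- The bound is the integer part of `(d - 2)² / 4`, which removes the parity distinction for
integers `x`. -/
theorem le_deformationBound {d : ℕ} {x : ℤ} (h : 4 * x ≤ ((d : ℤ) - 2) ^ 2) :
    (x : ℚ) ≤ deformationBound d := by
  unfold deformationBound
  split_ifs with hd
  · have : (4 * x : ℚ) ≤ ((d : ℚ) - 2) ^ 2 := by exact_mod_cast h
    linarith
  · obtain ⟨e, rfl⟩ := Nat.not_even_iff_odd.mp hd
    have h1 : 4 * x ≤ 4 * ((e : ℤ) ^ 2 - e) + 1 := by push_cast at h; linarith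
    have h2 : x ≤ (e : ℤ) ^ 2 - e := by omega
    have : (x : ℚ) ≤ (e : ℚ) ^ 2 - e := by exact_mod_cast h2
    push_cast
    linarith

theorem four_mul_le_of_le_deformationBound {d : ℕ} {x : ℤ} (h : (x : ℚ) ≤ deformationBound d) :
    4 * x ≤ ((d : ℤ) - 2) ^ 2 := by
  have : (4 * x : ℚ) ≤ ((d : ℚ) - 2) ^ 2 := by
    unfold deformationBound at h
    split_ifs at h <;> linarith
  exact_mod_cast this

namespace IsDefect

variable {φ q : ℕ → ℕ}

theorem three_le_reg (H : IsDefect φ q) {d : ℕ}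
    (hd : ∃ n₀ : ℕ, ∀ n ≥ n₀, φ n + d = (n + 2).choose 2) (h5 : 5 ≤ d) : 3 ≤ hilbertReg φ := by
  by_contra! h
  have h1 := H.sum_eq hd (N := 2) (by omega)
  rw [Finset.sum_range_succ, Finset.sum_range_one] at h1
  have := H.le_succ 0
  have := H.le_succ 1
  omega

/-- A large `g*` forces the defect to end with two ones. -/
theorem last_eq_one (H : IsDefect φ q) {d : ℕ}
    (hd : ∃ n₀ : ℕ, ∀ n ≥ n₀, φ n + d = (n + 2).choose 2) (h5 : 5 ≤ d)
    (hg : deformationBound d < (gStar d φ : ℚ)) {M : ℕ} (hM : hilbertReg φ = M + 2) :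
    q M = 1 ∧ q (M + 1) = 1 := by
  have h3 := H.three_le_reg hd h5
  have hp : ∀ i, i < M + 2 → 0 < q i := fun i hi => H.pos_of_lt_reg (hM ▸ hi)
  have hM1 : q M = 1 := by
    by_contra hne
    have hM2 : 2 ≤ q M := by have := hp M (by omega); omega
    refine absurd hg (not_lt.mpr (le_deformationBound ?_))
    have h1 := sum_sub_le_of_two_le M (hp 0 (by omega)) fun i hi hiM => by
      by_contra! hlt
      have := H.le_of_le (a := i) (n := M) (by omega) hiM
      omega
    have h2 := H.sum_eq hd hM.le
    zify at h2
    rw [H.gStar_eq hd hM.le]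
    rw [h2] at h1
    -- The bound is `1 + M d - (M + 1)² = M (d - 2) - M²`, at most `(d - 2)² / 4`.
    nlinarith [sq_nonneg ((d : ℤ) - 2 - 2 * M)]
  refine ⟨hM1, ?_⟩
  have h1 := H.anti M (by omega)
  have h2 := hp (M + 1) (by omega)
  omega

/-- Numerical consequences of a decomposition, which adds `1` to the shifted defect in each degree
below the regularity. -/
theorem add_colength_of_shift (H : IsDefect φ q) {d : ℕ}
    (hd : ∃ n₀ : ℕ, ∀ n ≥ n₀, φ n + d = (n + 2).choose 2) (h5 : 5 ≤ d)
    (hg : deformationBound d < (gStar d φ : ℚ)) {ψ p : ℕ → ℕ} (H' : IsDefect ψ p) {c : ℕ}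
    (hc : ∃ n₀ : ℕ, ∀ n ≥ n₀, ψ n + c = (n + 2).choose 2) (h0 : q 0 = 1)
    (hs : ∀ n, q (n + 1) = p n + if n + 1 < hilbertReg φ then 1 else 0) :
    hilbertReg φ + c = d ∧ c + 2 ≤ hilbertReg φ ∧
      ((gStar c ψ : ℚ) ≤ deformationBound c → 2 * c + 1 ≤ hilbertReg φ) := by
  have h3 := H.three_le_reg hd h5
  obtain ⟨M, hM⟩ : ∃ M, hilbertReg φ = M + 2 := ⟨hilbertReg φ - 2, by omega⟩
  obtain ⟨hM1, hM2⟩ := H.last_eq_one hd h5 hg hM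
  rw [hM] at hs
  -- `q M = 1` already contains the added one, hence `p (M - 1) = 0`.
  have hr : hilbertReg ψ + 1 ≤ M := by
    obtain ⟨M', rfl⟩ : ∃ M', M = M' + 1 := ⟨M - 1, by omega⟩
    have h1 := hs M'
    rw [hM1, if_pos (by omega)] at h1
    have := H'.reg_le (n := M') (by omega)
    omega
  set r := hilbertReg ψ with hrdef
  have hsumq := H.sum_eq hd hM.le
  have hsump := H'.sum_eq hc (N := M + 1) (by omega)
  have hsumpr := H'.sum_eq hc (N := r) le_rfl
  have hs' : ∀ n ∈ Finset.range (M + 1), q (n + 1) = p n + 1 := fun n hn => by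
    rw [hs, if_pos (by simp at hn; omega)]
  have hd' : M + 2 + c = d := by
    rw [Finset.sum_range_succ', Finset.sum_congr rfl hs', Finset.sum_add_distrib, hsump, h0] at hsumq
    simp at hsumq
    omega
  have hgφ := H.gStar_eq hd hM.le
  have hgψ := H'.gStar_eq hc (N := M + 1) (by omega)
  have hgψr := H'.gStar_eq hc (N := r) le_rfl
  have hrel : 2 * gStar d φ = 2 * gStar c ψ + (M + 2) * (M - 1) + 2 * c := by
    rw [hgφ, hgψ, Finset.sum_range_succ', h0]
    have h1 : ∑ i ∈ Finset.range (M + 1), (((i + 1 : ℕ) : ℤ) - 1) * (q (i + 1) : ℤ) =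
        ∑ i ∈ Finset.range (M + 1), ((i : ℤ) - 1) * p i + ∑ i ∈ Finset.range (M + 1), (p i : ℤ)
          + ∑ i ∈ Finset.range (M + 1), (i : ℤ) := by
      rw [← Finset.sum_add_distrib, ← Finset.sum_add_distrib]
      refine Finset.sum_congr rfl fun i hi => ?_
      rw [hs' i hi]; push_cast; ring
    have h2 := sum_range_two_mul_sub (M + 1) 0
    rw [← Finset.mul_sum] at h2
    simp only [sub_zero, Finset.sum_add_distrib] at h2
    simp at h2
    zify at hsump
    rw [h1, hsump]
    push_cast
    linarith
  have hg4 : (d - 2 : ℤ) ^ 2 < 4 * gStar d φ := by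
    by_contra! hle
    exact absurd hg (not_lt.mpr (le_deformationBound hle))
  have hdz : (d : ℤ) = M + 2 + c := by rw [← hd']; push_cast; ring
  rw [hdz] at hg4
  have hmc : c + 2 ≤ M + 2 := by
    by_contra! hlt
    have h1 := sum_sub_le_of_pos r fun i hi => H'.pos_of_lt_reg (hrdef ▸ hi)
    zify at hsumpr
    rw [hsumpr] at h1
    have hrz : (r : ℤ) + 1 ≤ M := by exact_mod_cast hr
    have hcz : (M : ℤ) + 1 ≤ c := by exact_mod_cast (by omega : M + 1 ≤ c)
    -- The left side increases in `r` for `r ≤ c`; the right side is its value at `r = M - 1`.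
    have hkey : 2 * ((r : ℤ) - 2) * c - r * (r - 1) ≤ 2 * (M - 3) * c - (M - 1) * (M - 2) := by
      nlinarith
    nlinarith
  refine ⟨by omega, by omega, fun hψ => ?_⟩
  have h1 := four_mul_le_of_le_deformationBound hψ
  by_contra! hlt
  have hMz : (M : ℤ) + 2 ≤ 2 * c := by exact_mod_cast (by omega : M + 2 ≤ 2 * c)
  have hM0 : (0 : ℤ) ≤ M := by positivity
  -- Inserting `4 g*(ψ) ≤ (c - 2)²` into `hrel` gives `(M + c)² < c² + 2M² + 2M`, that is `2Mc < M(M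
  -- + 2)`.
  nlinarith

end IsDefect

/-! ### Avoidance and general linear forms. -/

theorem exists_forall_notMem_of_finite {k E : Type*} [Field k] [Infinite k] [AddCommGroup E]
    [Module k E] {T : Set (Submodule k E)} (hT : T.Finite) (h : ∀ p ∈ T, p ≠ ⊤) :
    ∃ v : E, ∀ p ∈ T, v ∉ p := by
  have := hT.to_subtype
  by_contra! hc
  obtain ⟨p, hp⟩ := Subspace.exists_eq_top_of_iUnion_eq_univ (k := k) (p := fun p : T => p.1) (by
    ext v
    obtain ⟨p, hp, hv⟩ := hc v
    simp only [Set.mem_iUnion, Set.mem_univ, iff_true]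
    exact ⟨⟨p, hp⟩, hv⟩)
  exact h p.1 p.2 hp

/-- Otherwise a prime `P` over `F, G` lies strictly inside `Q`. It contains a prime factor `p` of
`F` and, by coprimality, is larger than `(p)`; the chain `0 < (p) < P < Q` contradicts Krull's bound
of two on the height of `Q`. -/
theorem mem_minimalPrimes_of_eq_span_pair {A : Type*} [CommRing A] [IsDomain A]
    [IsNoetherianRing A] [UniqueFactorizationMonoid A] {F G a b : A} (hF : F ≠ 0)
    (hFG : ∀ p, Prime p → p ∣ F → ¬ p ∣ G) {Q : Ideal A} [hQ : Q.IsPrime]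
    (hab : Q = Ideal.span {a, b}) (hle : Ideal.span {F, G} ≤ Q) :
    Q ∈ (Ideal.span {F, G}).minimalPrimes := by
  classical
  obtain ⟨P, hP, hPQ⟩ := Ideal.exists_minimalPrimes_le hle
  have hPp : P.IsPrime := hP.1.1
  have hFP : F ∈ P := hP.1.2 (Ideal.subset_span (by simp))
  have hGP : G ∈ P := hP.1.2 (Ideal.subset_span (by simp))
  rcases eq_or_lt_of_le hPQ with rfl | hlt
  · exact hP
  exfalso
  obtain ⟨f, hf, hfF⟩ := UniqueFactorizationMonoid.exists_prime_factors F hF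
  have hfP : f.prod ∈ P := P.mem_of_dvd hfF.symm.dvd hFP
  obtain ⟨p, hpf, hpP⟩ := (hPp.multiset_prod_mem_iff_exists_mem f).mp hfP
  have hpF : p ∣ F := (Multiset.dvd_prod hpf).trans hfF.dvd
  have hp : Prime p := hf p hpf
  have hpp : (Ideal.span {p}).IsPrime := (Ideal.span_singleton_prime hp.ne_zero).mpr hp
  have h1 : Ideal.span {p} < P := by
    refine lt_of_le_of_ne ((Ideal.span_singleton_le_iff_mem _).mpr hpP) ?_
    rintro rfl
    exact hFG p hp hpF (Ideal.mem_span_singleton.mp hGP)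
  have h0 : (⊥ : Ideal A) < Ideal.span {p} := by
    rw [bot_lt_iff_ne_bot, Ne, Ideal.span_singleton_eq_bot]
    exact hp.ne_zero
  have := Ideal.isPrime_bot (α := A)
  have e0 := Ideal.height_add_one_le_of_lt_of_isPrime h0
  have e1 := Ideal.height_add_one_le_of_lt_of_isPrime h1
  have e2 := Ideal.height_add_one_le_of_lt_of_isPrime hlt
  have e3 : Q.height ≤ 2 := by
    have hQm : Q ∈ (Ideal.span (({a, b} : Finset A) : Set A)).minimalPrimes := by
      rw [Finset.coe_pair, ← hab, Ideal.minimalPrimes_eq_subsingleton_self]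
      rfl
    refine (Ideal.height_le_card_of_mem_minimalPrimes_span_finset hQm).trans ?_
    exact_mod_cast Finset.card_le_two
  have e4 : (1 : ℕ∞) ≤ (Ideal.span {p}).height := le_trans (by simp) e0
  have e5 : (2 : ℕ∞) ≤ P.height := le_trans (by
    calc (2 : ℕ∞) = 1 + 1 := by norm_num
      _ ≤ _ := by gcongr) e1
  have e6 : (3 : ℕ∞) ≤ 2 := le_trans (by
    calc (3 : ℕ∞) = 2 + 1 := by norm_num
      _ ≤ P.height + 1 := by gcongr) (e2.trans e3)
  exact absurd e6 (by decide)

section Generic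

variable {k : Type*} [Field k]

theorem prime_of_isHomogeneous_one {σ : Type*} {ℓ : MvPolynomial σ k} (hℓ : ℓ.IsHomogeneous 1)
    (h0 : ℓ ≠ 0) : Prime ℓ := by
  have hdeg := hℓ.totalDegree h0
  rw [← UniqueFactorizationMonoid.irreducible_iff_prime]
  refine irreducible_of_totalDegree_eq_one hdeg fun x hx => ?_
  rw [isUnit_iff_ne_zero]
  rintro rfl
  exact h0 (by ext i; simpa using hx i)

/-- A linear form avoiding finitely many ideals, none of which contains all the variables. -/
theorem exists_linear_form_notMem [Infinite k] {T : Set (Ideal (MvPolynomial (Fin 3) k))}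
    (hT : T.Finite) (h : ∀ P ∈ T, ∃ i, X i ∉ P) :
    ∃ ℓ : MvPolynomial (Fin 3) k, ℓ.IsHomogeneous 1 ∧ ℓ ≠ 0 ∧ ∀ P ∈ T, ℓ ∉ P := by
  let g : Ideal (MvPolynomial (Fin 3) k) → Submodule k (homogeneousSubmodule (Fin 3) k 1) :=
    fun P => (P.restrictScalars k).comap (Submodule.subtype _)
  -- Avoiding `⊥` as well makes the form nonzero.
  obtain ⟨v, hv⟩ := exists_forall_notMem_of_finite (k := k) ((hT.insert ⊥).image g) (by
    rintro _ ⟨P, hP, rfl⟩ htop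
    obtain ⟨i, hi⟩ : ∃ i, X i ∉ P := by
      rcases hP with rfl | hP
      · exact ⟨0, by rw [Ideal.mem_bot]; exact X_ne_zero 0⟩
      · exact h P hP
    have : (⟨X i, isHomogeneous_X k i⟩ : homogeneousSubmodule (Fin 3) k 1) ∈ g P := by
      rw [htop]; exact Submodule.mem_top
    exact hi this)
  refine ⟨v.1, v.2, fun h0 => hv (g ⊥) ⟨⊥, Or.inl rfl, rfl⟩ ?_, fun P hP hPv =>
    hv (g P) ⟨P, Or.inr hP, rfl⟩ hPv⟩
  exact (Ideal.mem_bot.mpr h0 : v.1 ∈ (⊥ : Ideal (MvPolynomial (Fin 3) k)))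

/-- A linear form which is a non-zero-divisor modulo a saturated ideal, avoiding moreover finitely
many ideals. -/
theorem exists_linear_nonZeroDivisor [Infinite k] {I : Ideal (MvPolynomial (Fin 3) k)}
    (hI : IsSaturated I) {T : Set (Ideal (MvPolynomial (Fin 3) k))}
    (hT : T.Finite) (h : ∀ P ∈ T, ∃ i, X i ∉ P) :
    ∃ ℓ : MvPolynomial (Fin 3) k, ℓ.IsHomogeneous 1 ∧ ℓ ≠ 0 ∧ (∀ P ∈ T, ℓ ∉ P) ∧
      ∀ F, ℓ * F ∈ I ↔ F ∈ I := by
  let A := MvPolynomial (Fin 3) k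
  obtain ⟨ℓ, h1, h0, hℓ⟩ := exists_linear_form_notMem
    (hT.union (associatedPrimes.finite A (A ⧸ I))) (by
      rintro P (hP | hP)
      · exact h P hP
      -- An associated prime containing all variables is the annihilator of some class, which
      -- saturation forces to be zero.
      · by_contra! hc
        rw [AssociatedPrimes.mem_iff, isAssociatedPrime_iff] at hP
        obtain ⟨hPp, x, hx⟩ := hP
        obtain ⟨F, rfl⟩ := Ideal.Quotient.mk_surjective x
        have hF : F ∈ I := by
          refine hI F 1 fun i => ?_
          have := hc i
          rw [hx, Submodule.mem_colon_singleton, Submodule.mem_bot] at this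
          rw [pow_one, ← Ideal.Quotient.eq_zero_iff_mem, map_mul]
          exact this
        apply hPp.ne_top
        rw [hx, Ideal.Quotient.eq_zero_iff_mem.mpr hF]
        simp)
  refine ⟨ℓ, h1, h0, fun P hP => hℓ P (Or.inl hP), fun F => ⟨fun hF => ?_, I.mul_mem_left ℓ⟩⟩
  by_contra hFI
  have : ℓ ∈ ⋃ p ∈ associatedPrimes A (A ⧸ I), (p : Set A) := by
    rw [biUnion_associatedPrimes_eq_zero_divisors]
    refine ⟨Ideal.Quotient.mk I F, fun h => hFI (Ideal.Quotient.eq_zero_iff_mem.mp h), ?_⟩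
    change Ideal.Quotient.mk I (ℓ * F) = 0
    exact Ideal.Quotient.eq_zero_iff_mem.mpr hF
  simp only [Set.mem_iUnion] at this
  obtain ⟨P, hP, hℓP⟩ := this
  exact hℓ P (Or.inr hP) hℓP

theorem LineRestriction.diffFn_eq {h : MvPolynomial (Fin 3) k} (ρ : LineRestriction h)
    (hh : h.IsHomogeneous 1) (hh0 : h ≠ 0) {I : Ideal (MvPolynomial (Fin 3) k)}
    (hI : ∀ F, h * F ∈ I ↔ F ∈ I) (n : ℕ) :
    diffFn (hilbertFn I) n = Module.finrank k (ρ.image I n) := by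
  cases n with
  | zero => simp [diffFn, ρ.hilbertFn_zero hh hh0]
  | succ n => simp [diffFn, ρ.hilbertFn_succ hh hh0 hI]

theorem LineRestriction.isDefect {h : MvPolynomial (Fin 3) k} (ρ : LineRestriction h)
    (hh : h.IsHomogeneous 1) (hh0 : h ≠ 0) {I : Ideal (MvPolynomial (Fin 3) k)}
    (hI : ∀ F, h * F ∈ I ↔ F ∈ I) :
    IsDefect (hilbertFn I) fun n => n + 1 - Module.finrank k (ρ.image I n) where
  diff_add n := by
    have := ρ.finrank_image_le I n
    rw [ρ.diffFn_eq hh hh0 hI]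
    omega
  le_succ n := Nat.sub_le _ _
  anti n hn := by
    change n + 1 - Module.finrank k (ρ.image I n) ≤ n at hn
    have := ρ.finrank_image_succ I n (by
      intro h0
      rw [h0, finrank_bot] at hn
      omega)
    omega

theorem exists_isDefect [Infinite k] {I : Ideal (MvPolynomial (Fin 3) k)} (hI : IsSaturated I) :
    ∃ q, IsDefect (hilbertFn I) q := by
  obtain ⟨h, h1, h0, -, hI'⟩ := exists_linear_nonZeroDivisor hI Set.finite_empty (by simp)
  obtain ⟨ρ⟩ := exists_lineRestriction h1 h0
  exact ⟨_, ρ.isDefect h1 h0 hI'⟩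

theorem IsDefect.finrank_image {h : MvPolynomial (Fin 3) k} (ρ : LineRestriction h)
    (hh : h.IsHomogeneous 1) (hh0 : h ≠ 0) {I : Ideal (MvPolynomial (Fin 3) k)}
    (hI : ∀ F, h * F ∈ I ↔ F ∈ I) {q : ℕ → ℕ} (H : IsDefect (hilbertFn I) q) (n : ℕ) :
    Module.finrank k (ρ.image I n) + q n = n + 1 := by
  have h1 := H.diff_add n
  rw [ρ.diffFn_eq hh hh0 hI] at h1
  exact_mod_cast h1

/-- A space of polynomials without common prime factor contains two such polynomials. -/
theorem exists_pair_of_no_common_prime [Infinite k] {σ : Type*}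
    {V : Submodule k (MvPolynomial σ k)} (hV0 : V ≠ ⊥)
    (hV : ∀ p : MvPolynomial σ k, Prime p → ∃ F ∈ V, ¬ p ∣ F) :
    ∃ F ∈ V, ∃ G ∈ V, F ≠ 0 ∧ ∀ p, Prime p → p ∣ F → ¬ p ∣ G := by
  classical
  obtain ⟨F, hF, hF0⟩ := V.ne_bot_iff.mp hV0
  obtain ⟨f, hf, hfF⟩ := UniqueFactorizationMonoid.exists_prime_factors F hF0
  let g : MvPolynomial σ k → Submodule k V := fun p =>
    ((Ideal.span {p}).restrictScalars k).comap V.subtype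
  have hg : ∀ p (G : V), G ∈ g p ↔ p ∣ G.1 := fun p G => Ideal.mem_span_singleton
  obtain ⟨G, hG⟩ := exists_forall_notMem_of_finite (k := k)
    ((f.toFinset : Finset (MvPolynomial σ k)).finite_toSet.image g) (by
      rintro _ ⟨p, hp, rfl⟩ htop
      obtain ⟨G, hG, hpG⟩ := hV p (hf p (by simpa using hp))
      exact hpG ((hg p ⟨G, hG⟩).mp (htop ▸ Submodule.mem_top)))
  refine ⟨F, hF, G.1, G.2, hF0, fun p hp hpF hpG => ?_⟩
  obtain ⟨p', hp', hpp'⟩ := Prime.exists_mem_multiset_dvd hp (hpF.trans hfF.symm.dvd)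
  have hass := hp.associated_of_dvd (hf p' hp') hpp'
  exact hG (g p') ⟨p', by simpa using hp', rfl⟩ ((hg p' G).mpr (hass.symm.dvd.trans hpG))

theorem exists_common_prime [Infinite k] {I : Ideal (MvPolynomial (Fin 3) k)}
    (hI : IsSaturated I) {q : ℕ → ℕ} (H : IsDefect (hilbertFn I) q) {M : ℕ}
    (hM : q M = 1) (hM' : q (M + 1) = 1) :
    ∃ p : MvPolynomial (Fin 3) k, Prime p ∧ ∀ F ∈ degreePart I (M + 1), p ∣ F := by
  by_contra! hc
  have hV0 : degreePart I (M + 1) ≠ ⊥ := by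
    intro h0
    obtain ⟨h, h1, hh0, -, hI'⟩ := exists_linear_nonZeroDivisor hI Set.finite_empty (by simp)
    obtain ⟨ρ⟩ := exists_lineRestriction h1 hh0
    have := H.finrank_image ρ h1 hh0 hI' (M + 1)
    rw [LineRestriction.image, h0, Submodule.map_bot, finrank_bot] at this
    omega
  obtain ⟨F, hF, G, hG, hF0, hFG⟩ := exists_pair_of_no_common_prime hV0 hc
  -- The line must miss the common zeros of `F` and `G`: these are the minimal primes of `(F, G)`
  -- not containing all variables.
  obtain ⟨h, h1, h0, hhT, hI'⟩ := exists_linear_nonZeroDivisor hI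
    (T := {P ∈ (Ideal.span {F, G}).minimalPrimes | ∃ i, X i ∉ P})
    ((Ideal.finite_minimalPrimes_of_isNoetherianRing _ _).subset fun _ h => h.1) fun _ h => h.2
  obtain ⟨ρ⟩ := exists_lineRestriction h1 h0
  have hdim := H.finrank_image ρ h1 h0 hI'
  obtain ⟨ℓ, hℓ1, hℓ0, hℓ⟩ := exists_linear_factor_of_codim_one (ρ.image_le I M)
    (ρ.image_le I (M + 1)) (fun _ hF i => ρ.mul_mem_image hF (isHomogeneous_X k i))
    (by have := hdim M; omega) (by have := hdim (M + 1); omega)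
  have hℓp := prime_of_isHomogeneous_one hℓ1 hℓ0
  have : (Ideal.span {ℓ}).IsPrime := (Ideal.span_singleton_prime hℓ0).mpr hℓp
  -- `Q` is the ideal of the point of the line cut out by `ℓ`. It contains `F`, `G` and `h`, against
  -- the choice of `h`.
  let Q : Ideal (MvPolynomial (Fin 3) k) := (Ideal.span {ℓ}).comap ρ.res
  have hQp : Q.IsPrime := Ideal.IsPrime.comap _
  have hQmem : ∀ x, x ∈ Q ↔ ℓ ∣ ρ.res x := fun x => Ideal.mem_span_singleton
  have hQ : Q = Ideal.span {h, ρ.sec ℓ} := by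
    ext x
    rw [hQmem, Ideal.mem_span_pair]
    constructor
    · rintro ⟨w, hw⟩
      have h2 : ρ.res (x - ρ.sec w * ρ.sec ℓ) = 0 := by
        rw [map_sub, map_mul, ρ.res_sec, ρ.res_sec, hw]; ring
      obtain ⟨y, hy⟩ := (ρ.res_eq_zero_iff _).mp h2
      exact ⟨y, ρ.sec w, by linear_combination -hy⟩
    · rintro ⟨a, b, rfl⟩
      rw [map_add, map_mul, map_mul, (ρ.res_eq_zero_iff h).mpr dvd_rfl, ρ.res_sec]
      exact ⟨ρ.res b, by ring⟩
  have hle : Ideal.span {F, G} ≤ Q := by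
    rw [Ideal.span_le]
    rintro x (rfl | rfl)
    · exact (hQmem _).mpr (hℓ _ (ρ.res_mem_image hF))
    · exact (hQmem _).mpr (hℓ _ (ρ.res_mem_image hG))
  have hmin := mem_minimalPrimes_of_eq_span_pair hF0 hFG hQ hle
  refine hhT Q ⟨hmin, ?_⟩ (by rw [hQmem, (ρ.res_eq_zero_iff h).mpr dvd_rfl]; exact dvd_zero _)
  by_contra! hX
  have hdvd : ∀ j, ℓ ∣ X j := by
    intro j
    obtain ⟨a, ha⟩ := exists_coeff_of_isHomogeneous_one
      (ρ.sec_isHomogeneous _ _ (isHomogeneous_X k j))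
    rw [← ρ.res_sec (X j), ← hQmem, ha]
    exact Q.sum_mem fun i _ => Q.mul_mem_left _ (hX i)
  have h2 := (hℓp.associated_of_dvd X_prime (hdvd 0)).symm.dvd.trans (hdvd 1)
  rw [X_dvd_X] at h2
  simp at h2

theorem exists_common_linear_factor [Infinite k] {I : Ideal (MvPolynomial (Fin 3) k)}
    (hI : IsSaturated I) {q : ℕ → ℕ} (H : IsDefect (hilbertFn I) q) {M : ℕ}
    (hM : q M = 1) (hM' : q (M + 1) = 1) :
    ∃ ℓ : MvPolynomial (Fin 3) k, ℓ.IsHomogeneous 1 ∧ ℓ ≠ 0 ∧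
      ∀ F ∈ degreePart I (M + 1), ℓ ∣ F := by
  obtain ⟨p, hp, hpdvd⟩ := exists_common_prime hI H hM hM'
  obtain ⟨h, h1, h0, -, hI'⟩ := exists_linear_nonZeroDivisor hI Set.finite_empty (by simp)
  obtain ⟨ρ⟩ := exists_lineRestriction h1 h0
  have hdim := H.finrank_image ρ h1 h0 hI' (M + 1)
  set e := p.totalDegree with he
  set t := homogeneousComponent e p with ht
  have ht0 : t ≠ 0 := homogeneousComponent_totalDegree_ne_zero hp.ne_zero
  have hte : t.IsHomogeneous e := homogeneousComponent_isHomogeneous _ _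
  have htdvd : ∀ F ∈ degreePart I (M + 1), t ∣ F := fun F hF =>
    homogeneousComponent_totalDegree_dvd hF.2 (hpdvd F hF)
  have he1 : 1 ≤ e := by
    by_contra! hlt
    have h2 : p.totalDegree = 0 := by omega
    rw [totalDegree_eq_zero_iff_eq_C] at h2
    refine hp.not_isUnit ?_
    rw [h2]
    refine (isUnit_iff_ne_zero.mpr fun hc => hp.ne_zero ?_).map C
    rw [h2, hc, C_0]
  obtain ⟨w, hw, hw0⟩ := (ρ.image I (M + 1)).ne_bot_iff.mp fun hb => by
    rw [hb, finrank_bot] at hdim; omega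
  obtain ⟨F, hF, rfl⟩ := hw
  obtain ⟨G, hG⟩ := htdvd F hF
  have hF0 : F ≠ 0 := by rintro rfl; exact hw0 (map_zero _)
  have heM : e ≤ M + 1 := by
    rw [← hte.totalDegree ht0, ← hF.2.totalDegree hF0]
    exact totalDegree_le_of_dvd_of_isDomain ⟨G, hG⟩ hF0
  have hrt : ρ.res t ≠ 0 := by
    intro hz
    apply hw0
    change ρ.res F = 0
    rw [hG, map_mul, hz, zero_mul]
  have hle : ρ.image I (M + 1) ≤
      (homogeneousSubmodule (Fin 2) k (M + 1 - e)).map (polyMul (ρ.res t)) := by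
    rintro _ ⟨F, hF, rfl⟩
    obtain ⟨G, rfl⟩ := htdvd F hF
    have hG : G.IsHomogeneous (M + 1 - e) :=
      isHomogeneous_of_mul hte ht0 (by rw [Nat.add_sub_cancel' heM]; exact hF.2)
    exact ⟨ρ.res G, ρ.res_isHomogeneous _ _ hG, (map_mul ρ.res t G).symm⟩
  -- The image has dimension `M + 1` and consists of multiples of a form of degree `e`, so `M + 1 ≤
  -- M + 2 - e`.
  have hdim' := Submodule.finrank_mono hle
  rw [finrank_map_polyMul hrt, finrank_homogeneousSubmodule_fin_two] at hdim'
  have : e = 1 := by omega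
  exact ⟨t, this ▸ hte, ht0, htdvd⟩

end Generic

/-! ### The residual ideal and the decomposition. -/

section Decomposition

variable {k : Type*} [Field k]

/-- The ideal quotient `(I : ℓ)`. -/
noncomputable def quotientBy (I : Ideal (MvPolynomial (Fin 3) k)) (ℓ : MvPolynomial (Fin 3) k) :
    Ideal (MvPolynomial (Fin 3) k) :=
  Submodule.comap (LinearMap.mulLeft (MvPolynomial (Fin 3) k) ℓ) I

theorem mem_quotientBy {I : Ideal (MvPolynomial (Fin 3) k)} {ℓ F : MvPolynomial (Fin 3) k} :
    F ∈ quotientBy I ℓ ↔ ℓ * F ∈ I := Iff.rfl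

theorem isSaturated_quotientBy {I : Ideal (MvPolynomial (Fin 3) k)} (hI : IsSaturated I)
    (ℓ : MvPolynomial (Fin 3) k) : IsSaturated (quotientBy I ℓ) := by
  intro F N hF
  refine mem_quotientBy.mpr (hI _ N fun i => ?_)
  have := mem_quotientBy.mp (hF i)
  rwa [mul_left_comm] at this

theorem homogeneousComponent_mem_quotientBy {I : Ideal (MvPolynomial (Fin 3) k)}
    (hI : ∀ F ∈ I, ∀ n : ℕ, homogeneousComponent n F ∈ I) {ℓ : MvPolynomial (Fin 3) k} {e : ℕ}
    (hℓ : ℓ.IsHomogeneous e) {F : MvPolynomial (Fin 3) k} (hF : F ∈ quotientBy I ℓ) (n : ℕ) :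
    homogeneousComponent n F ∈ quotientBy I ℓ := by
  rw [mem_quotientBy, ← homogeneousComponent_mul_of_isHomogeneous hℓ]
  exact hI _ hF _

section Quotient

variable {ℓ : MvPolynomial (Fin 3) k} (ρ : LineRestriction ℓ)

theorem LineRestriction.defect_zero (hℓ : ℓ.IsHomogeneous 1) (h0 : ℓ ≠ 0)
    {I : Ideal (MvPolynomial (Fin 3) k)} {q : ℕ → ℕ} (H : IsDefect (hilbertFn I) q) :
    q 0 + Module.finrank k (ρ.image I 0) = 1 := by
  have h1 := H.diff_add 0
  have h2 := ρ.hilbertFn_zero hℓ h0 I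
  simp only [diffFn] at h1
  push_cast at h1
  omega

/-- Difference of the dimension counts for `0 → K_n → I_{n+1} → image → 0` in consecutive degrees.
Here `ℓ` may be a zero-divisor modulo `I`; the defects come from other lines. -/
theorem LineRestriction.defect_succ (hℓ : ℓ.IsHomogeneous 1) (h0 : ℓ ≠ 0)
    {I K : Ideal (MvPolynomial (Fin 3) k)} (hIK : ∀ F, ℓ * F ∈ I ↔ F ∈ K) {q p : ℕ → ℕ}
    (H : IsDefect (hilbertFn I) q) (H' : IsDefect (hilbertFn K) p) (n : ℕ) :
    q (n + 1) + Module.finrank k (ρ.image I (n + 1)) =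
      p n + 1 + Module.finrank k (ρ.image I n) := by
  have h1 := H.diff_add (n + 1)
  have h2 := ρ.hilbertFn_succ hℓ h0 hIK n
  have h3 := H'.diff_add n
  simp only [diffFn] at h1
  cases n with
  | zero =>
    have h4 := ρ.hilbertFn_zero hℓ h0 I
    simp only [diffFn] at h3
    rw [zero_add] at h1 h2 ⊢
    push_cast at h1 h3
    omega
  | succ n =>
    have h4 := ρ.hilbertFn_succ hℓ h0 hIK n
    simp only [diffFn] at h3
    push_cast at h1 h3
    omega

end Quotient

theorem exists_not_dvd_of_colength [Infinite k] {I : Ideal (MvPolynomial (Fin 3) k)} {d : ℕ}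
    (hI : IsIdealOfColength I d) {ℓ : MvPolynomial (Fin 3) k} (hℓ : ℓ.IsHomogeneous 1)
    (h0 : ℓ ≠ 0) : ∃ F ∈ I, ¬ ℓ ∣ F := by
  by_contra! hc
  obtain ⟨ρ⟩ := exists_lineRestriction hℓ h0
  obtain ⟨q, H⟩ := exists_isDefect hI.isSaturated
  obtain ⟨p, H'⟩ := exists_isDefect (isSaturated_quotientBy hI.isSaturated ℓ)
  have him : ∀ n, Module.finrank k (ρ.image I n) = 0 := by
    intro n
    rw [show ρ.image I n = ⊥ from ?_, finrank_bot]
    rw [eq_bot_iff]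
    rintro _ ⟨F, hF, rfl⟩
    exact (ρ.res_eq_zero_iff F).mpr (hc F hF.1)
  -- With zero restrictions the recursion reads `q (n + 1) = p n + 1`, so `q` would never vanish.
  have h1 := ρ.defect_succ hℓ h0 (K := quotientBy I ℓ) (fun F => Iff.rfl) H H'
    (hilbertReg (hilbertFn I))
  rw [him, him, H.eq_zero_of_reg_le hI.hilbert_eventually (Nat.le_succ _)] at h1
  omega

namespace IsDecomposition

variable {I K : Ideal (MvPolynomial (Fin 3) k)} {m c : ℕ} {ℓ f : MvPolynomial (Fin 3) k}

theorem exists_of_mem (D : IsDecomposition I m ℓ K c f) {F : MvPolynomial (Fin 3) k}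
    (hF : F ∈ I) : ∃ a ∈ K, ∃ b, F = ℓ * a + f * b := by
  rw [D.eq] at hF
  obtain ⟨x, hx, y, hy, rfl⟩ := Submodule.mem_sup.mp hF
  obtain ⟨a, ha, rfl⟩ := Ideal.mem_span_singleton_mul.mp hx
  obtain ⟨b, rfl⟩ := Ideal.mem_span_singleton.mp hy
  exact ⟨a, ha, b, rfl⟩

theorem not_dvd [Infinite k] (D : IsDecomposition I m ℓ K c f) {d : ℕ}
    (hI : IsIdealOfColength I d) : ¬ ℓ ∣ f := by
  intro h
  obtain ⟨F, hF, hFℓ⟩ := exists_not_dvd_of_colength hI D.linear D.linear_ne_zero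
  apply hFℓ
  obtain ⟨a, -, b, rfl⟩ := D.exists_of_mem hF
  exact dvd_add (dvd_mul_right _ _) (h.mul_right b)

theorem mul_mem (D : IsDecomposition I m ℓ K c f) {a : MvPolynomial (Fin 3) k} (ha : a ∈ K) :
    ℓ * a ∈ I := by
  rw [D.eq]
  exact Submodule.mem_sup_left (Ideal.mul_mem_mul (Ideal.mem_span_singleton_self ℓ) ha)

theorem form_mem_left (D : IsDecomposition I m ℓ K c f) : f ∈ I := by
  rw [D.eq]
  exact Submodule.mem_sup_right (Ideal.mem_span_singleton_self f)

theorem mul_mem_iff (D : IsDecomposition I m ℓ K c f) (hf : ¬ ℓ ∣ f)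
    (F : MvPolynomial (Fin 3) k) : ℓ * F ∈ I ↔ F ∈ K := by
  refine ⟨fun hF => ?_, D.mul_mem⟩
  obtain ⟨a, ha, b, hab⟩ := D.exists_of_mem hF
  have hℓ := prime_of_isHomogeneous_one D.linear D.linear_ne_zero
  have hb : ℓ ∣ f * b := ⟨F - a, by linear_combination -hab⟩
  obtain ⟨b', rfl⟩ := (hℓ.dvd_or_dvd hb).resolve_left hf
  have : F = a + b' * f := mul_left_cancel₀ D.linear_ne_zero (by linear_combination hab)
  rw [this]
  exact K.add_mem ha (K.mul_mem_left _ D.form_mem.1)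

theorem finrank_image (D : IsDecomposition I m ℓ K c f) (hf : ¬ ℓ ∣ f) (ρ : LineRestriction ℓ)
    (n : ℕ) : Module.finrank k (ρ.image I n) = n + 1 - m := by
  have hf0 : ρ.res f ≠ 0 := fun h => hf ((ρ.res_eq_zero_iff f).mp h)
  have hfm : (ρ.res f).IsHomogeneous m := ρ.res_isHomogeneous f m D.form_mem.2
  have hres : ∀ F ∈ I, ∃ b, ρ.res F = ρ.res f * b := by
    intro F hF
    obtain ⟨a, -, b, rfl⟩ := D.exists_of_mem hF
    refine ⟨ρ.res b, ?_⟩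
    rw [map_add, map_mul, map_mul, (ρ.res_eq_zero_iff ℓ).mpr dvd_rfl, zero_mul, zero_add]
  rcases lt_or_ge n m with hn | hn
  · rw [show ρ.image I n = ⊥ from ?_, finrank_bot]
    · omega
    rw [eq_bot_iff]
    rintro _ ⟨F, hF, rfl⟩
    by_contra hF0
    have hF0 : ρ.res F ≠ 0 := hF0
    obtain ⟨b, hb⟩ := hres F hF.1
    have h1 := totalDegree_le_of_dvd_of_isDomain ⟨b, hb⟩ hF0
    rw [hfm.totalDegree hf0, (ρ.res_isHomogeneous F n hF.2).totalDegree hF0] at h1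
    omega
  · obtain ⟨j, rfl⟩ := Nat.exists_eq_add_of_le hn
    have : ρ.image I (m + j) = (homogeneousSubmodule (Fin 2) k j).map (polyMul (ρ.res f)) := by
      apply le_antisymm
      · rintro _ ⟨F, hF, rfl⟩
        obtain ⟨b, hb⟩ := hres F hF.1
        refine ⟨b, isHomogeneous_of_mul hfm hf0 ?_, hb.symm⟩
        rw [← hb]
        exact ρ.res_isHomogeneous F _ hF.2
      · rintro _ ⟨b, hb, rfl⟩
        rw [polyMul_apply, mul_comm]
        exact ρ.mul_mem_image (ρ.res_mem_image ⟨D.form_mem_left, D.form_mem.2⟩) hb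
    rw [this, finrank_map_polyMul hf0, finrank_homogeneousSubmodule_fin_two]
    omega

end IsDecomposition

theorem exists_decomposition [Infinite k] {I : Ideal (MvPolynomial (Fin 3) k)} {d : ℕ}
    (hI : IsIdealOfColength I d) {q : ℕ → ℕ} (H : IsDefect (hilbertFn I) q) {M : ℕ}
    (hM : hilbertReg (hilbertFn I) = M + 2) (hq : q M = 1) (hq' : q (M + 1) = 1) :
    ∃ (ℓ : MvPolynomial (Fin 3) k) (K : Ideal (MvPolynomial (Fin 3) k)) (c : ℕ)
      (f : MvPolynomial (Fin 3) k), IsDecomposition I (M + 2) ℓ K c f := by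
  obtain ⟨ℓ, hℓ, h0, hdvd⟩ := exists_common_linear_factor hI.isSaturated H hq hq'
  obtain ⟨ρ⟩ := exists_lineRestriction hℓ h0
  have hKsat := isSaturated_quotientBy hI.isSaturated ℓ
  obtain ⟨p, H'⟩ := exists_isDefect hKsat
  have hsucc := ρ.defect_succ hℓ h0 (K := quotientBy I ℓ) (fun F => Iff.rfl) H H'
  have him0 : Module.finrank k (ρ.image I (M + 1)) = 0 := by
    rw [show ρ.image I (M + 1) = ⊥ from ?_, finrank_bot]
    rw [eq_bot_iff]
    rintro _ ⟨F, hF, rfl⟩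
    exact (ρ.res_eq_zero_iff F).mpr (hdvd F hF)
  have hmono : Monotone fun n => Module.finrank k (ρ.image I n) :=
    monotone_nat_of_le_succ (ρ.finrank_image_succ_le I)
  have him : ∀ n ≤ M + 1, Module.finrank k (ρ.image I n) = 0 := fun n hn =>
    Nat.le_zero.mp (him0 ▸ hmono hn)
  have hpM : p M = 0 := by
    have := hsucc M
    rw [him0, him M (by omega), hq'] at this
    omega
  have hp : ∀ n, M ≤ n → p n = 0 := fun n hn => by
    have := H'.le_of_le (a := M) (by omega) hn
    omega
  -- Here `p` vanishes from `M` on and `q` from `M + 2` on, so the image grows by exactly one per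
  -- degree, as do the multiples of one form of degree `M + 2`.
  have himj : ∀ j, Module.finrank k (ρ.image I (M + 1 + j)) = j := by
    intro j
    induction j with
    | zero => exact him0
    | succ j ih =>
      have := hsucc (M + 1 + j)
      rw [ih, hp _ (by omega), H.eq_zero_of_reg_le hI.hilbert_eventually (by omega)] at this
      rw [← add_assoc]
      omega
  obtain ⟨w, hw, hw0⟩ := (ρ.image I (M + 2)).ne_bot_iff.mp fun hb => by
    have := himj 1
    rw [hb, finrank_bot] at this
    omega
  obtain ⟨f, hf, rfl⟩ := hw
  have hf0 : ρ.res f ≠ 0 := hw0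
  refine ⟨ℓ, quotientBy I ℓ, ∑ i ∈ Finset.range M, p i, f, hℓ, h0, ⟨fun F hF n =>
    homogeneousComponent_mem_quotientBy hI.homogeneous hℓ hF n, hKsat, M, fun n hn => ?_⟩,
    ⟨I.mul_mem_left ℓ hf.1, hf.2⟩, le_antisymm ?_ ?_⟩
  · rw [← H'.add_sum n]
    congr 1
    refine Finset.sum_subset (fun i hi => ?_) fun i _ hi => ?_
    · simp at hi ⊢; omega
    · simp at hi; exact hp i hi
  · intro F hF
    rw [← sum_homogeneousComponent F]
    refine Submodule.sum_mem _ fun n _ => ?_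
    have hFn : homogeneousComponent n F ∈ degreePart I n :=
      ⟨hI.homogeneous F hF n, homogeneousComponent_isHomogeneous n F⟩
    generalize homogeneousComponent n F = G at hFn
    obtain ⟨b, hb⟩ : ∃ b, ρ.res G = ρ.res f * b := by
      rcases Nat.lt_or_ge n (M + 2) with hn | hn
      · have := him n (by omega)
        rw [Submodule.finrank_eq_zero] at this
        have h1 := ρ.res_mem_image hFn
        rw [this, Submodule.mem_bot] at h1
        exact ⟨0, by rw [h1, mul_zero]⟩
      · obtain ⟨j, rfl⟩ := Nat.exists_eq_add_of_le hn
        have hle : (homogeneousSubmodule (Fin 2) k j).map (polyMul (ρ.res f)) ≤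
            ρ.image I (M + 2 + j) := by
          rintro _ ⟨b, hb, rfl⟩
          rw [polyMul_apply, mul_comm]
          exact ρ.mul_mem_image (ρ.res_mem_image hf) hb
        have heq := Submodule.eq_of_le_of_finrank_le hle (by
          rw [finrank_map_polyMul hf0, finrank_homogeneousSubmodule_fin_two]
          have := himj (j + 1)
          rw [show M + 1 + (j + 1) = M + 2 + j by ring] at this
          exact this.le)
        have h1 := ρ.res_mem_image hFn
        rw [← heq] at h1
        obtain ⟨b, -, hb⟩ := h1
        exact ⟨b, hb.symm⟩
    have h2 : ρ.res (G - f * ρ.sec b) = 0 := by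
      rw [map_sub, map_mul, ρ.res_sec, hb, sub_self]
    obtain ⟨a, ha⟩ := (ρ.res_eq_zero_iff _).mp h2
    have haK : a ∈ quotientBy I ℓ := by
      rw [mem_quotientBy, ← ha]
      exact I.sub_mem hFn.1 (I.mul_mem_right _ hf.1)
    rw [show G = ℓ * a + f * ρ.sec b by rw [← ha]; ring]
    exact Submodule.add_mem _
      (Submodule.mem_sup_left (Ideal.mul_mem_mul (Ideal.mem_span_singleton_self ℓ) haK))
      (Submodule.mem_sup_right (Ideal.mul_mem_right _ _ (Ideal.mem_span_singleton_self f)))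
  · refine sup_le (Ideal.mul_le.mpr fun x hx a ha => ?_)
      ((Ideal.span_singleton_le_iff_mem _).mpr hf.1)
    obtain ⟨y, rfl⟩ := Ideal.mem_span_singleton.mp hx
    rw [mul_right_comm]
    exact I.mul_mem_right _ ha

end Decomposition

theorem lemma2p4 {k : Type*} [Field k] [Algebra ℂ k] (d : ℕ) (hd : 5 ≤ d)
    (I : Ideal (MvPolynomial (Fin 3) k)) (hI : IsIdealOfColength I d)
    (hg : deformationBound d < (gStar d (hilbertFn I) : ℚ)) :
    (∃ (ℓ : MvPolynomial (Fin 3) k) (K : Ideal (MvPolynomial (Fin 3) k)) (c : ℕ)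
        (f : MvPolynomial (Fin 3) k),
      IsDecomposition I (hilbertReg (hilbertFn I)) ℓ K c f) ∧
    ∀ (ℓ : MvPolynomial (Fin 3) k) (K : Ideal (MvPolynomial (Fin 3) k)) (c : ℕ)
        (f : MvPolynomial (Fin 3) k),
      IsDecomposition I (hilbertReg (hilbertFn I)) ℓ K c f →
        hilbertReg (hilbertFn I) + c = d ∧
        c + 2 ≤ hilbertReg (hilbertFn I) ∧
        (5 ≤ c → (gStar c (hilbertFn K) : ℚ) ≤ deformationBound c →
          2 * c + 1 ≤ hilbertReg (hilbertFn I)) := by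
  -- The field `ℂ` enters only by making `k` infinite.
  have : Infinite k := Infinite.of_injective _ (algebraMap ℂ k).injective
  obtain ⟨q, H⟩ := exists_isDefect hI.isSaturated
  have hev := hI.hilbert_eventually
  have hm3 := H.three_le_reg hev hd
  constructor
  · obtain ⟨M, hM⟩ : ∃ M, hilbertReg (hilbertFn I) = M + 2 :=
      ⟨hilbertReg (hilbertFn I) - 2, by omega⟩
    obtain ⟨h1, h2⟩ := H.last_eq_one hev hd hg hM
    rw [hM]
    exact exists_decomposition hI H hM h1 h2
  · intro ℓ K c f D
    have hf := D.not_dvd hI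
    obtain ⟨ρ⟩ := exists_lineRestriction D.linear D.linear_ne_zero
    obtain ⟨p, H'⟩ := exists_isDefect D.colength.isSaturated
    have hz := ρ.defect_zero D.linear D.linear_ne_zero H
    rw [D.finrank_image hf ρ] at hz
    obtain ⟨h1, h2, h3⟩ := H.add_colength_of_shift hev hd hg H' D.colength.hilbert_eventually
      (by omega) fun n => by
        have := ρ.defect_succ D.linear D.linear_ne_zero (D.mul_mem_iff hf) H H' n
        rw [D.finrank_image hf ρ, D.finrank_image hf ρ] at this
        -- The truncated dimensions `n + 2 - m` and `n + 1 - m` differ by one exactly when `n + 1 ≥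
        -- m`, cancelling the added one there.
        split_ifs <;> omega
    exact ⟨h1, h2, fun _ => h3⟩
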